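/- Let $A$ and $B$ be groups with subgroups $H\le A$ and $K\le B$, let $\varphi:H\to K$ be an isomorphism, and let $G=\langle A*B;\ H=K,\ \varphi\rangle$ be the free product of $A$ and $B$ with $H$ and $K$ amalgamated according to $\varphi$, that is, the quotient of $A*B$ by the normal closure of $\{h\,\varphi(h)^{-1} : h\in H\}$. Suppose that $H$ is a retract of $A$ and $K$ is a retract of $B$, where a subgroup $Y$ of a group $X$ is called a retract of $X$ if there is a normal subgroup $F$ of $X$ with $X=YF$ and $Y\cap F=1$. Then: 1. $G$ is residually finite if and only if both $A$ and $B$ are residually finite. 2. For every prime $p$, $G$ is residually $p$-finite if and only if both $A$ and $B$ are residually $p$-finite. Here a group $X$ is residually finite (residually $p$-finite) if for every $x\in X$ with $x\ne 1$ there is a homomorphism from $X$ onto a finite group (a finite $p$-group) that does not send $x$ to $1$. -/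

import Mathlib

/-- A subgroup `H` of `G` is a retract of `G` if there is a normal subgroup `F` of `G` with
`G = H F` and `H ∩ F = 1`. -/
def Subgroup.IsRetract {G : Type*} [Group G] (H : Subgroup G) : Prop :=
  ∃ F : Subgroup G, F.Normal ∧ (∀ g : G, ∃ h ∈ H, ∃ f ∈ F, g = h * f) ∧ H ⊓ F = ⊥

/-- `G` is residually `p`-finite if every nontrivial element has nontrivial image in some
quotient of `G` that is a finite `p`-group. -/
def Group.ResiduallyPFinite (p : ℕ) (G : Type*) [Group G] : Prop :=
  ∀ g : G, g ≠ 1 → ∃ N : Subgroup G, ∃ _ : N.Normal,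
    Finite (G ⧸ N) ∧ IsPGroup p (G ⧸ N) ∧ g ∉ N

/-- The free product `⟨A * B; H = K, φ⟩` of `A` and `B` with the subgroups `H` and `K` amalgamated
according to `φ`: the quotient of the free product of `A` and `B` by the normal closure of all
elements `h φ(h)⁻¹` with `h` in `H`. -/
abbrev AmalgamatedProduct {A B : Type*} [Group A] [Group B] {H : Subgroup A} {K : Subgroup B}
    (φ : H ≃* K) : Type _ :=
  Monoid.Coprod A B ⧸ Subgroup.normalClosure
    (Set.range fun h : H =>
      (Monoid.Coprod.inl (h : A) : Monoid.Coprod A B) * (Monoid.Coprod.inr (φ h : B))⁻¹)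

/-! The retractions give homomorphisms from `G` onto `A`, `B` and `H`. The first two are left
inverses of the canonical maps, so `A` and `B` embed in `G` and inherit its residual properties.

Conversely, a nontrivial element of `H` is detected in `A`, and every element outside `H` is a word
with letters alternately in `A \ H` and `B \ H`. Finite quotients of `A` and `B` that keep each
letter apart from its retraction yield a finite group `C` and homomorphisms `e b`, `r` from `G` to
`C`: on factor `b`, `e (!b)` agrees with `r`, while `e b` differs from `r` at the letters taken from
that factor.

Then `G` acts by matrices over `F_p[C ^ N]`: on factor `b`, the diagonal representation `diagHom`
conjugated by `shear b`. On `H` the diagonal matrices are scalar, so the two conjugates agree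
(`shearHom_eq_shearHom`). For a word of length `n`, a suitable entry `(i, i + n)` is a product of
differences of group elements, nonzero because each letter is separated in its own coordinate of `C
^ N` (`IsAlternating.apply_prod_ne_zero`). The image is finite. If `C` is a `p`-group, so is the
image, being triangular in characteristic `p` with elements of `C ^ N` on the diagonal
(`exists_pow_eq_one_of_mem_groupTriangular`). -/

open scoped MonoidAlgebra

/-- No cancellation is possible: on the supports of `u * z` and `v * z` the `j`-th coordinate takes
the distinct values `u j * c` and `v j * c`. -/
theorem MonoidAlgebra.sub_mul_ne_zero {k ι C : Type*} [Ring k] [Group C]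
    {u v : ι → C} {z : k[ι → C]} (hz : z ≠ 0) {j : ι} {c : C} (huv : u j ≠ v j)
    (hc : ∀ q, z.coeff q ≠ 0 → q j = c) :
    (MonoidAlgebra.of k _ u - MonoidAlgebra.of k _ v) * z ≠ 0 := by
  obtain ⟨q, hq⟩ : ∃ q, z.coeff q ≠ 0 := by
    by_contra! h
    exact hz (MonoidAlgebra.ext (Finsupp.ext h))
  intro h
  have h1 := congrArg (fun y : k[ι → C] => y.coeff (u * q)) h
  simp only [sub_mul, MonoidAlgebra.of_apply, MonoidAlgebra.coeff_sub, Finsupp.sub_apply,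
    MonoidAlgebra.coeff_single_mul_apply, inv_mul_cancel_left, one_mul,
    MonoidAlgebra.coeff_zero, Finsupp.zero_apply, sub_eq_zero] at h1
  have h2 := hc _ (h1 ▸ hq)
  rw [Pi.mul_apply, Pi.mul_apply, hc q hq, Pi.inv_apply, inv_mul_eq_iff_eq_mul] at h2
  exact huv (mul_right_cancel h2)

/-! ### Alternating words -/

/-- `IsAlternating S b l` says that the entries of `l` lie in `S b`, `S !b`, `S b`, … in turn. -/
def IsAlternating {G : Type*} (S : Bool → Set G) : Bool → List G → Prop
  | _, [] => True
  | b, x :: l => x ∈ S b ∧ IsAlternating S (!b) l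

theorem IsAlternating.mono {G : Type*} {S T : Bool → Set G} {b : Bool} {l : List G}
    (h : IsAlternating S b l) (hST : ∀ b, ∀ x ∈ S b, x ∈ l → x ∈ T b) : IsAlternating T b l := by
  induction l generalizing b with
  | nil => trivial
  | cons x l ih =>
    exact ⟨hST b x h.1 (by simp), ih h.2 fun b y hy hyl => hST b y hy (by simp [hyl])⟩

/-- Every element of a group generated by two subgroups `X false` and `X true` containing `Z`
lies in `Z` or is a product of elements taken alternately from `X false \ Z` and `X true \ Z`. -/
theorem exists_isAlternating_prod_eq {G : Type*} [Group G] (X : Bool → Subgroup G)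
    (Z : Subgroup G) (hZ : ∀ b, Z ≤ X b) (hX : ⨆ b, X b = ⊤) (g : G) :
    g ∈ Z ∨ ∃ b l, l ≠ [] ∧ IsAlternating (fun b => X b \ Z) b l ∧ l.prod = g := by
  have step : ∀ c, ∀ y ∈ X c, ∀ b l, IsAlternating (fun b => (X b \ Z : Set G)) b l →
      ∃ z ∈ Z, ∃ b l', IsAlternating (fun b => (X b \ Z : Set G)) b l' ∧
        z * l'.prod = y * l.prod := by
    intro c y hy b l hl
    by_cases hyZ : y ∈ Z
    · exact ⟨y, hyZ, b, l, hl, rfl⟩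
    cases l with
    | nil => exact ⟨1, Z.one_mem, c, [y], ⟨⟨hy, hyZ⟩, trivial⟩, by simp⟩
    | cons x l =>
      by_cases hbc : b = c
      · subst hbc
        by_cases hyx : y * x ∈ Z
        · exact ⟨y * x, hyx, !b, l, hl.2, by simp [mul_assoc]⟩
        · exact ⟨1, Z.one_mem, b, (y * x) :: l, ⟨⟨mul_mem hy hl.1.1, hyx⟩, hl.2⟩,
            by simp [mul_assoc]⟩
      · obtain rfl : b = !c := by cases b <;> cases c <;> simp_all
        exact ⟨1, Z.one_mem, c, y :: x :: l, ⟨⟨hy, hyZ⟩, hl⟩, by simp⟩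
  have hg : g ∈ Subgroup.closure (⋃ b, (X b : Set G)) := by
    rw [← Subgroup.iSup_eq_closure, hX]
    trivial
  -- The prefix `z` lies in both subgroups, so the next generator on the left absorbs it.
  have key : ∃ z ∈ Z, ∃ b l, IsAlternating (fun b => (X b \ Z : Set G)) b l ∧ z * l.prod = g := by
    induction hg using Subgroup.closure_induction_left with
    | one => exact ⟨1, Z.one_mem, true, [], trivial, by simp⟩
    | mul_left x hx g hg ih =>
      obtain ⟨z, hz, b, l, hl, rfl⟩ := ih
      obtain ⟨c, hc⟩ := Set.mem_iUnion.1 hx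
      simpa [mul_assoc] using step c (x * z) (mul_mem hc (hZ c hz)) b l hl
    | inv_mul_cancel x hx g hg ih =>
      obtain ⟨z, hz, b, l, hl, rfl⟩ := ih
      obtain ⟨c, hc⟩ := Set.mem_iUnion.1 hx
      simpa [mul_assoc] using step c (x⁻¹ * z) (mul_mem (inv_mem hc) (hZ c hz)) b l hl
  obtain ⟨z, hz, b, l, hl, rfl⟩ := key
  cases l with
  | nil => exact .inl (by simpa using hz)
  | cons x l =>
    refine .inr ⟨b, (z * x) :: l, by simp, ⟨⟨mul_mem (hZ b hz) hl.1.1, fun h => hl.1.2 ?_⟩, hl.2⟩,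
      by simp [mul_assoc]⟩
    exact (Subgroup.mul_mem_cancel_left Z hz).1 h

/-! ### The matrix representations of the factors -/

section Representation

variable {G C : Type*} [Group G] [Group C] (k : Type*) [CommRing k] (N : ℕ)
  (e : Bool → G →* C) (r : G →* C)

/-- The homomorphism to `C ^ N` which is `e (i mod 2)` in the `i`-th coordinate and `r` in all
the others. -/
def coordHom (i : Fin N) : G →* (Fin N → C) :=
  MonoidHom.pi fun j => if j = i then e (Nat.bodd i) else r

theorem coordHom_apply (i j : Fin N) (g : G) :
    coordHom N e r i g j = if j = i then e (Nat.bodd i) g else r g := by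
  change (if j = i then e (Nat.bodd i) else r) g = _
  split_ifs <;> rfl

/-- The diagonal matrix with `i`-th entry `coordHom N e r i g`. -/
noncomputable def diagHom : G →* Matrix (Fin N) (Fin N) k[Fin N → C] :=
  (Matrix.diagonalRingHom (Fin N) k[Fin N → C]).toMonoidHom.comp
    (MonoidHom.pi fun i => (MonoidAlgebra.of k _).comp (coordHom N e r i))

theorem diagHom_apply (g : G) :
    diagHom k N e r g = Matrix.diagonal fun i => MonoidAlgebra.of k _ (coordHom N e r i g) := rfl

/-- The sum of the matrix units at `(i, i + 1)` with `i + 1` of parity `b`. -/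
def stepMatrix (R : Type*) [Ring R] (b : Bool) : Matrix (Fin N) (Fin N) R :=
  Matrix.of fun i j => if (j : ℕ) = i + 1 ∧ Nat.bodd j = b then 1 else 0

variable {N} in
theorem stepMatrix_apply (R : Type*) [Ring R] (b : Bool) (i j : Fin N) :
    stepMatrix N R b i j = if (j : ℕ) = i + 1 ∧ Nat.bodd j = b then 1 else 0 := rfl

/-- A nonzero term would need two successive column indices `l` and `l + 1` of the same parity. -/
theorem stepMatrix_mul_diagonal_mul (R : Type*) [Ring R] (b : Bool) (d : Fin N → R) :
    stepMatrix N R b * Matrix.diagonal d * stepMatrix N R b = 0 := by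
  ext i j
  rw [Matrix.mul_apply]
  refine Finset.sum_eq_zero fun l _ => ?_
  rw [Matrix.mul_diagonal, stepMatrix_apply, stepMatrix_apply]
  by_cases h1 : (l : ℕ) = i + 1 ∧ Nat.bodd l = b
  · by_cases h2 : (j : ℕ) = l + 1 ∧ Nat.bodd j = b
    · have := h2.2
      rw [h2.1, Nat.bodd_succ, h1.2] at this
      simp at this
    · simp [h2]
  · simp [h1]

theorem stepMatrix_mul_self (R : Type*) [Ring R] (b : Bool) :
    stepMatrix N R b * stepMatrix N R b = 0 := by
  simpa using stepMatrix_mul_diagonal_mul N R b 1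

/-- The unitriangular matrix `1 + stepMatrix N R b`. -/
def shear (R : Type*) [Ring R] (b : Bool) : (Matrix (Fin N) (Fin N) R)ˣ where
  val := 1 + stepMatrix N R b
  inv := 1 - stepMatrix N R b
  val_inv := by simp [add_mul, mul_sub, stepMatrix_mul_self]
  inv_val := by simp [sub_mul, mul_add, stepMatrix_mul_self]

/-- The conjugate of `diagHom k N e r` by `shear N k[Fin N → C] b`. -/
noncomputable def shearHom (b : Bool) : G →* (Matrix (Fin N) (Fin N) k[Fin N → C])ˣ :=
  (MulAut.conj (shear N k[Fin N → C] b)).toMonoidHom.comp (diagHom k N e r).toHomUnits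

theorem shearHom_apply (b : Bool) (g : G) (i j : Fin N) :
    (shearHom k N e r b g : Matrix _ _ _) i j =
      if i = j then MonoidAlgebra.of k _ (coordHom N e r i g) else
      if (j : ℕ) = i + 1 ∧ Nat.bodd j = b then
        MonoidAlgebra.of k _ (coordHom N e r j g) - MonoidAlgebra.of k _ (coordHom N e r i g)
      else 0 := by
  have h : (shearHom k N e r b g : Matrix _ _ _) =
      diagHom k N e r g + stepMatrix N _ b * diagHom k N e r g
        - diagHom k N e r g * stepMatrix N _ b := by
    change (1 + stepMatrix N _ b) * diagHom k N e r g * (1 - stepMatrix N _ b) = _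
    have := stepMatrix_mul_diagonal_mul N k[Fin N → C] b
      (fun i => MonoidAlgebra.of k _ (coordHom N e r i g))
    rw [← diagHom_apply] at this
    rw [mul_sub, mul_one, add_mul, one_mul, add_mul, this]
    abel
  rw [h, diagHom_apply, Matrix.sub_apply, Matrix.add_apply, Matrix.mul_diagonal,
    Matrix.diagonal_mul, stepMatrix_apply]
  by_cases hij : i = j
  · subst hij
    simp
  · rw [Matrix.diagonal_apply_ne _ hij]
    split_ifs <;> simp

/-- Where every `e b` agrees with `r`, the diagonal matrix is scalar and commutes with both shears.
This makes the representations compatible on the amalgamated subgroup. -/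
theorem shearHom_eq_shearHom {g : G} (hg : ∀ b, e b g = r g) {g' : G} (hgg' : r g = r g')
    (hg' : ∀ b, e b g' = r g') (b b' : Bool) :
    shearHom k N e r b g = shearHom k N e r b' g' := by
  have hc : ∀ g : G, (∀ b, e b g = r g) → ∀ i, coordHom N e r i g = fun _ => r g := by
    intro g hg i
    ext j
    rw [coordHom_apply]
    split_ifs <;> simp [hg]
  ext i j
  rw [shearHom_apply, shearHom_apply]
  simp [hc g hg, hc g' hg', hgg']

/-! ### Matrix entries of alternating words -/

section Word

variable {k N e r} {X : Bool → Subgroup G}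
  {Ψ : G →* (Matrix (Fin N) (Fin N) k[Fin N → C])ˣ}

theorem shearHom_apply_of_gt {b : Bool} {g : G} {i j : Fin N} (h : (i : ℕ) + 1 < j) :
    (shearHom k N e r b g).val i j = 0 := by
  rw [shearHom_apply, if_neg (by rintro rfl; omega), if_neg (by omega)]

theorem shearHom_apply_of_lt {b : Bool} {g : G} {i j : Fin N} (h : j < i) :
    (shearHom k N e r b g).val i j = 0 := by
  rw [shearHom_apply, if_neg (by rintro rfl; simp at h), if_neg (by omega)]

/-- An alternating word of length `n` has zero entries above the `n`-th superdiagonal. -/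
theorem IsAlternating.apply_prod_of_gt (hΨ : ∀ b, ∀ x ∈ X b, Ψ x = shearHom k N e r b x)
    {b : Bool} {l : List G} (hl : IsAlternating (fun b => (X b : Set G)) b l) {i j : Fin N}
    (hij : (i : ℕ) + l.length < j) : (Ψ l.prod).val i j = 0 := by
  induction l generalizing b i with
  | nil => simpa using Matrix.one_apply_ne (by rintro rfl; simp at hij)
  | cons x l ih =>
    rw [List.prod_cons, map_mul, Units.val_mul, Matrix.mul_apply]
    refine Finset.sum_eq_zero fun m _ => ?_
    rw [List.length_cons] at hij
    rw [hΨ b x hl.1]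
    by_cases hm : (m : ℕ) ≤ i + 1
    · rw [ih hl.2 (by omega), mul_zero]
    · rw [shearHom_apply_of_gt (by omega), zero_mul]

/-- Each letter climbs at most one superdiagonal, so only the path `i, i + 1, …, j` contributes. The
claim on coordinates `m ≤ i` carries the induction: coordinate `i + 1` is constant on the support of
the later factors, while the current letter takes two different values there. -/
theorem IsAlternating.apply_prod_ne_zero [Nontrivial k]
    (hX : ∀ b, ∀ x ∈ X b, e (!b) x = r x)
    (hΨ : ∀ b, ∀ x ∈ X b, Ψ x = shearHom k N e r b x)
    {b : Bool} {l : List G} (hl : IsAlternating (fun b => {x | x ∈ X b ∧ e b x ≠ r x}) b l)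
    {i j : Fin N} (hib : Nat.bodd i = !b) (hij : (i : ℕ) + l.length = j) :
    (Ψ l.prod).val i j ≠ 0 ∧
      ∀ m ≤ i, ∀ q, ((Ψ l.prod).val i j).coeff q ≠ 0 → q m = r l.prod := by
  induction l generalizing b i with
  | nil =>
    obtain rfl : i = j := Fin.ext (by simpa using hij)
    simp only [List.prod_nil, map_one, Units.val_one, Matrix.one_apply_eq]
    refine ⟨one_ne_zero, fun m _ q hq => ?_⟩
    classical
    rw [MonoidAlgebra.one_def, MonoidAlgebra.coeff_single, Finsupp.single_apply] at hq
    obtain rfl : 1 = q := by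
      by_contra h
      simp [h] at hq
    simp
  | cons x l ih =>
    rw [List.length_cons] at hij
    have hl' : IsAlternating (fun b => (X b : Set G)) (!b) l := hl.2.mono fun b x hx _ => hx.1
    let i' : Fin N := ⟨i + 1, by omega⟩
    have hi'b : Nat.bodd i' = b := by simp [i', hib]
    obtain ⟨h0, hc⟩ := ih hl.2 (i := i') (by simp [hi'b]) (by simp [i']; omega)
    have hx : (Ψ x).val i i' =
        MonoidAlgebra.of k _ (coordHom N e r i' x) - MonoidAlgebra.of k _ (coordHom N e r i x) := by
      rw [hΨ b x hl.1.1, shearHom_apply, if_neg (by simp [i', Fin.ext_iff]),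
        if_pos ⟨rfl, hi'b⟩]
    have hmul : (Ψ (x :: l).prod).val i j =
        (MonoidAlgebra.of k _ (coordHom N e r i' x) - MonoidAlgebra.of k _ (coordHom N e r i x)) *
          (Ψ l.prod).val i' j := by
      rw [List.prod_cons, map_mul, Units.val_mul, Matrix.mul_apply, ← hx]
      refine Finset.sum_eq_single i' (fun m _ hm => ?_) (by simp)
      have hm' : (m : ℕ) ≠ i + 1 := fun h => hm (Fin.ext h)
      by_cases hmi : (m : ℕ) ≤ i
      · rw [hl'.apply_prod_of_gt hΨ (by omega), mul_zero]
      · rw [hΨ b x hl.1.1, shearHom_apply_of_gt (by omega), zero_mul]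
    have hi : ∀ m, coordHom N e r i x m = r x := fun m => by
      rw [coordHom_apply, hib, hX b x hl.1.1, ite_self]
    have hi' : ∀ m ≤ i, coordHom N e r i' x m = r x := fun m hm => by
      rw [coordHom_apply, if_neg (by rintro rfl; simp [i', Fin.le_def] at hm)]
    rw [hmul]
    constructor
    · refine MonoidAlgebra.sub_mul_ne_zero h0 (j := i') ?_ (hc i' le_rfl)
      rw [hi, coordHom_apply, if_pos rfl, hi'b]
      exact hl.1.2
    · intro m hm q hq
      have hm' : m ≤ i' := hm.trans (by simp [i', Fin.le_def])
      simp only [sub_mul, MonoidAlgebra.of_apply, MonoidAlgebra.coeff_sub, Finsupp.sub_apply,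
        MonoidAlgebra.coeff_single_mul_apply, one_mul] at hq
      rw [List.prod_cons, map_mul]
      by_cases h : ((Ψ l.prod).val i' j).coeff ((coordHom N e r i' x)⁻¹ * q) = 0
      · rw [h, zero_sub, neg_ne_zero] at hq
        have := hc m hm' _ hq
        rwa [Pi.mul_apply, Pi.inv_apply, hi, inv_mul_eq_iff_eq_mul] at this
      · have := hc m hm' _ h
        rwa [Pi.mul_apply, Pi.inv_apply, hi' m hm, inv_mul_eq_iff_eq_mul] at this

end Word

end Representation

/-! ### Triangular matrices of `p`-power order -/

theorem Matrix.pow_apply_of_strictUpper {R : Type*} [Ring R] {N : ℕ}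
    {M : Matrix (Fin N) (Fin N) R} (hM : ∀ i j, j ≤ i → M i j = 0) (n : ℕ) (i j : Fin N)
    (hij : (j : ℕ) < i + n) : (M ^ n) i j = 0 := by
  induction n generalizing j with
  | zero => simpa using Matrix.one_apply_ne (by rintro rfl; simp at hij)
  | succ n ih =>
    rw [pow_succ, Matrix.mul_apply]
    refine Finset.sum_eq_zero fun l _ => ?_
    by_cases hl : (l : ℕ) < i + n
    · rw [ih l hl, zero_mul]
    · rw [hM l j (by rw [Fin.le_def]; omega), mul_zero]

theorem Matrix.mul_apply_self_of_upper {R : Type*} [Ring R] {N : ℕ}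
    {M M' : Matrix (Fin N) (Fin N) R} (hM : ∀ i j, j < i → M i j = 0)
    (hM' : ∀ i j, j < i → M' i j = 0) (i : Fin N) : (M * M') i i = M i i * M' i i := by
  rw [Matrix.mul_apply]
  refine Finset.sum_eq_single i (fun l _ hl => ?_) (by simp)
  rcases lt_or_gt_of_ne hl with hl | hl
  · rw [hM i l hl, zero_mul]
  · rw [hM' l i hl, mul_zero]

/-- The monoid of upper triangular matrices over a group algebra with group elements on the
diagonal. -/
def groupTriangular (k Q : Type*) [CommRing k] [Group Q] (N : ℕ) :
    Submonoid (Matrix (Fin N) (Fin N) k[Q]) where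
  carrier := {M | (∀ i j, j < i → M i j = 0) ∧ ∀ i, ∃ q, M i i = MonoidAlgebra.of k Q q}
  one_mem' := ⟨fun i j h => Matrix.one_apply_ne h.ne',
    fun i => ⟨1, by rw [map_one, Matrix.one_apply_eq]⟩⟩
  mul_mem' := by
    rintro M M' ⟨h, hd⟩ ⟨h', hd'⟩
    refine ⟨fun i j hij => ?_, fun i => ?_⟩
    · rw [Matrix.mul_apply]
      refine Finset.sum_eq_zero fun l _ => ?_
      rcases lt_or_ge l i with hl | hl
      · rw [h i l hl, zero_mul]
      · rw [h' l j (hij.trans_le hl), mul_zero]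
    · obtain ⟨q, hq⟩ := hd i
      obtain ⟨q', hq'⟩ := hd' i
      exact ⟨q * q', by rw [Matrix.mul_apply_self_of_upper h h', map_mul, ← hq, ← hq']⟩

/-- If `p ^ a` kills `Q`, then `M ^ p ^ a` is unipotent. In characteristic `p`, its `p ^ N`-th power
minus `1` is the `p ^ N`-th power of a strictly upper triangular matrix, which vanishes since `N < p
^ N`. -/
theorem exists_pow_eq_one_of_mem_groupTriangular {p : ℕ} [Fact p.Prime] {Q : Type*} [Group Q]
    [Finite Q] (hQ : IsPGroup p Q) {N : ℕ} {M : Matrix (Fin N) (Fin N) (ZMod p)[Q]}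
    (hM : M ∈ groupTriangular (ZMod p) Q N) : ∃ n, M ^ p ^ n = 1 := by
  rcases isEmpty_or_nonempty (Fin N) with _ | _
  · exact ⟨0, Subsingleton.elim _ _⟩
  have : CharP (Matrix (Fin N) (Fin N) (ZMod p)[Q]) p :=
    charP_of_injective_algebraMap (algebraMap (ZMod p) _).injective p
  obtain ⟨a, ha⟩ := isPGroup_iff_exists_pow_pow_eq_one.1 hQ
  have hpow : ∀ n i, (M ^ n) i i = M i i ^ n := by
    intro n i
    induction n with
    | zero => simp
    | succ n ih =>
      rw [pow_succ, pow_succ, Matrix.mul_apply_self_of_upper (pow_mem hM n).1 hM.1, ih]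
  have hstrict : ∀ i j, j ≤ i → (M ^ p ^ a - 1) i j = 0 := by
    intro i j hij
    rw [Matrix.sub_apply]
    rcases hij.lt_or_eq with h | rfl
    · rw [(pow_mem hM _).1 i j h, Matrix.one_apply_ne h.ne', sub_zero]
    · obtain ⟨q, hq⟩ := hM.2 j
      rw [hpow, hq, ← map_pow, ha, map_one, Matrix.one_apply_eq, sub_self]
  refine ⟨a + N, ?_⟩
  rw [pow_add, pow_mul, ← sub_eq_zero]
  have h := sub_pow_char_pow_of_commute (x := M ^ p ^ a) (y := 1) p N (Commute.one_right _)
  rw [one_pow] at h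
  rw [← h]
  ext i j
  have hN : N < p ^ N := Nat.lt_pow_self (Fact.out : p.Prime).one_lt
  rw [Matrix.pow_apply_of_strictUpper hstrict _ i j (by omega), Matrix.zero_apply]

theorem shearHom_mem_groupTriangular {G C k : Type*} [Group G] [Group C] [CommRing k] (N : ℕ)
    (e : Bool → G →* C) (r : G →* C) (b : Bool) (g : G) :
    (shearHom k N e r b g).val ∈ groupTriangular k (Fin N → C) N :=
  ⟨fun _ _ h => shearHom_apply_of_lt h, fun i => ⟨coordHom N e r i g, by
    rw [shearHom_apply, if_pos rfl]⟩⟩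

theorem IsPGroup.pi_const {ι C : Type*} [Group C] [Finite C] {p : ℕ} (hC : IsPGroup p C) :
    IsPGroup p (ι → C) := by
  obtain ⟨a, ha⟩ := isPGroup_iff_exists_pow_pow_eq_one.1 hC
  exact isPGroup_iff_pow_pow_eq_one.2 fun g => ⟨a, funext fun i => ha (g i)⟩

theorem IsPGroup.prod {G G' : Type*} [Group G] [Group G'] {p : ℕ} (hG : IsPGroup p G)
    (hG' : IsPGroup p G') : IsPGroup p (G × G') := by
  rw [isPGroup_iff_pow_pow_eq_one] at *
  rintro ⟨g, g'⟩
  obtain ⟨m, hm⟩ := hG g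
  obtain ⟨n, hn⟩ := hG' g'
  refine ⟨m + n, Prod.ext ?_ ?_⟩
  · rw [Prod.pow_fst, pow_add, pow_mul, hm, one_pow, Prod.fst_one]
  · rw [Prod.pow_snd, add_comm, pow_add, pow_mul, hn, one_pow, Prod.snd_one]

/-! ### The finite quotient detecting an alternating word -/

theorem IsAlternating.exists_normal_prod_notMem {G C : Type*} [Group G] [Group C] [Finite C]
    {p : ℕ} [Fact p.Prime] {e : Bool → G →* C} {r : G →* C} {X : Bool → Subgroup G}
    (hX : ∀ b, ∀ x ∈ X b, e (!b) x = r x) (hgen : ⨆ b, X b = ⊤)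
    (hlift : ∀ N, ∃ Ψ : G →* (Matrix (Fin N) (Fin N) (ZMod p)[Fin N → C])ˣ,
      ∀ b, ∀ x ∈ X b, Ψ x = shearHom (ZMod p) N e r b x)
    {b : Bool} {l : List G} (hl : IsAlternating (fun b => {x | x ∈ X b ∧ e b x ≠ r x}) b l)
    (hne : l ≠ []) :
    ∃ N : Subgroup G, ∃ _ : N.Normal,
      Finite (G ⧸ N) ∧ (IsPGroup p C → IsPGroup p (G ⧸ N)) ∧ l.prod ∉ N := by
  obtain ⟨N, hN⟩ : ∃ N, N = l.length + 2 := ⟨_, rfl⟩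
  obtain ⟨Ψ, hΨ⟩ := hlift N
  have : Finite (ZMod p)[Fin N → C] :=
    Finite.of_injective (fun x => (x.coeff : (Fin N → C) → ZMod p))
      fun x y h => MonoidAlgebra.ext (DFunLike.coe_injective h)
  have : Finite (Matrix (Fin N) (Fin N) (ZMod p)[Fin N → C]) := by unfold Matrix; infer_instance
  refine ⟨Ψ.ker, inferInstance, Finite.of_injective _ (QuotientGroup.kerLift_injective Ψ),
    fun hC => ?_, ?_⟩
  · have hmem : ∀ g, (Ψ g).val ∈ groupTriangular (ZMod p) (Fin N → C) N := by
      intro g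
      have hg : g ∈ ⨆ b, X b := by rw [hgen]; trivial
      induction hg using Subgroup.iSup_induction' with
      | hp b x hx => rw [hΨ b x hx]; exact shearHom_mem_groupTriangular N e r b x
      | h1 => rw [map_one]; exact one_mem _
      | hmul x y _ _ hx hy => rw [map_mul]; exact mul_mem hx hy
    rw [isPGroup_iff_pow_pow_eq_one]
    rintro ⟨g⟩
    obtain ⟨n, hn⟩ := exists_pow_eq_one_of_mem_groupTriangular hC.pi_const (hmem g)
    refine ⟨n, (QuotientGroup.eq_one_iff (g ^ p ^ n)).2 ?_⟩
    rw [MonoidHom.mem_ker, map_pow]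
    exact Units.ext hn
  · rw [MonoidHom.mem_ker]
    intro h
    have hpos := List.length_pos_iff.2 hne
    -- The starting row must have parity opposite to that of the first letter's factor; size
    -- `l.length + 2` leaves room for either choice.
    obtain ⟨s, hs, hsb⟩ : ∃ s : ℕ, s ≤ 1 ∧ Nat.bodd s = !b := by
      cases b
      · exact ⟨1, le_rfl, rfl⟩
      · exact ⟨0, zero_le_one, rfl⟩
    refine (hl.apply_prod_ne_zero (i := ⟨s, by omega⟩) (j := ⟨s + l.length, by omega⟩)
      hX hΨ hsb rfl).1 ?_
    rw [h, Units.val_one, Matrix.one_apply_ne (by simp [Fin.ext_iff]; omega)]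

/-! ### Retractions and residual properties -/

theorem Subgroup.IsRetract.exists_retraction {G : Type*} [Group G] {H : Subgroup G}
    (hH : H.IsRetract) : ∃ r : G →* H, ∀ h : H, r h = h := by
  obtain ⟨F, hF, hmul, hinf⟩ := hH
  let f : H →* G ⧸ F := (QuotientGroup.mk' F).comp H.subtype
  have hf : Function.Bijective f := by
    constructor
    · rw [injective_iff_map_eq_one]
      intro h hh
      have hhF : (h : G) ∈ F := (QuotientGroup.eq_one_iff _).1 hh
      have : (h : G) ∈ H ⊓ F := ⟨h.2, hhF⟩
      rw [hinf, Subgroup.mem_bot] at this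
      exact Subtype.ext this
    · rintro ⟨g⟩
      obtain ⟨h, hh, x, hx, rfl⟩ := hmul g
      refine ⟨⟨h, hh⟩, (QuotientGroup.eq).2 ?_⟩
      simpa using hx
  let E := MulEquiv.ofBijective f hf
  exact ⟨E.symm.toMonoidHom.comp (QuotientGroup.mk' F), fun h => E.symm_apply_apply h⟩

/-- Every nontrivial element survives in a finite quotient, which is a `p`-group if `c` holds. -/
def Group.ResiduallyFiniteOrPFinite (c : Prop) (p : ℕ) (G : Type*) [Group G] : Prop :=
  ∀ g : G, g ≠ 1 → ∃ N : Subgroup G, ∃ _ : N.Normal,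
    Finite (G ⧸ N) ∧ (c → IsPGroup p (G ⧸ N)) ∧ g ∉ N

namespace Group.ResiduallyFiniteOrPFinite

theorem false_iff (p : ℕ) (G : Type*) [Group G] :
    Group.ResiduallyFiniteOrPFinite False p G ↔ Group.ResiduallyFinite G := by
  rw [Group.residuallyFinite_iff_exists_finiteIndexNormalSubgroup]
  refine forall₂_congr fun g _ => ⟨?_, ?_⟩
  · rintro ⟨N, hN, hfin, -, hg⟩
    have := Subgroup.finiteIndex_of_finite_quotient (H := N)
    exact ⟨.ofSubgroup N, hg⟩
  · rintro ⟨N, hg⟩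
    exact ⟨N.toSubgroup, inferInstance, inferInstance, False.elim, hg⟩

theorem true_iff (p : ℕ) (G : Type*) [Group G] :
    Group.ResiduallyFiniteOrPFinite True p G ↔ Group.ResiduallyPFinite p G := by
  simp [Group.ResiduallyFiniteOrPFinite, Group.ResiduallyPFinite]

variable {c : Prop} {p : ℕ} {G G' : Type*} [Group G] [Group G']

theorem exists_notMem_of_hom (hG' : Group.ResiduallyFiniteOrPFinite c p G') (f : G →* G') {g : G}
    (hg : f g ≠ 1) : ∃ N : Subgroup G, ∃ _ : N.Normal,
      Finite (G ⧸ N) ∧ (c → IsPGroup p (G ⧸ N)) ∧ g ∉ N := by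
  obtain ⟨N, hN, hfin, hp, hgN⟩ := hG' (f g) hg
  let f' := (QuotientGroup.mk' N).comp f
  have hker : f'.ker = N.comap f := by
    rw [← MonoidHom.comap_ker, QuotientGroup.ker_mk']
  refine ⟨f'.ker, inferInstance, Finite.of_injective _ (QuotientGroup.kerLift_injective f'),
    fun h => (hp h).of_injective _ (QuotientGroup.kerLift_injective f'), ?_⟩
  rwa [hker]

theorem of_injective (hG' : Group.ResiduallyFiniteOrPFinite c p G') (f : G →* G')
    (hf : Function.Injective f) : Group.ResiduallyFiniteOrPFinite c p G :=
  fun _ hg => hG'.exists_notMem_of_hom f ((map_ne_one_iff f hf).2 hg)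

theorem exists_forall_mem_list (hG : Group.ResiduallyFiniteOrPFinite c p G) (l : List G) :
    ∃ N : Subgroup G, ∃ _ : N.Normal,
      Finite (G ⧸ N) ∧ (c → IsPGroup p (G ⧸ N)) ∧ ∀ g ∈ l, g ≠ 1 → g ∉ N := by
  induction l with
  | nil =>
    have := QuotientGroup.subsingleton_quotient_top (G := G)
    exact ⟨⊤, inferInstance, inferInstance, fun _ => .of_subsingleton p _, by simp⟩
  | cons g l ih =>
    by_cases hg : g = 1
    · simpa [hg] using ih
    obtain ⟨N, hN, hfin, hp, hl⟩ := ih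
    obtain ⟨N', hN', hfin', hp', hg'⟩ := hG g hg
    let f := (QuotientGroup.mk' N).prod (QuotientGroup.mk' N')
    have hker : f.ker = N ⊓ N' := by
      rw [MonoidHom.ker_prod, QuotientGroup.ker_mk', QuotientGroup.ker_mk']
    have hf := QuotientGroup.kerLift_injective f
    refine ⟨f.ker, inferInstance, Finite.of_injective _ hf,
      fun h => ((hp h).prod (hp' h)).of_injective _ hf, ?_⟩
    rw [hker]
    intro x hx hx1 hxN
    rcases List.mem_cons.1 hx with rfl | hx
    · exact hg' hxN.2
    · exact hl x hx hx1 hxN.1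

end Group.ResiduallyFiniteOrPFinite

/-! ### The amalgamated product -/

namespace AmalgamatedProduct

variable {A B : Type*} [Group A] [Group B] {H : Subgroup A} {K : Subgroup B} (φ : H ≃* K)

/-- The canonical map from the first factor. -/
def inl : A →* AmalgamatedProduct φ := (QuotientGroup.mk' _).comp Monoid.Coprod.inl

/-- The canonical map from the second factor. -/
def inr : B →* AmalgamatedProduct φ := (QuotientGroup.mk' _).comp Monoid.Coprod.inr

theorem inl_eq_inr (h : H) : inl φ h = inr φ (φ h) := by
  rw [← mul_inv_eq_one, ← map_inv]
  refine (QuotientGroup.eq_one_iff _).2 (Subgroup.subset_normalClosure ⟨h, ?_⟩)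
  rw [map_inv]

variable {φ} {P : Type*} [Group P]

/-- The universal property of the amalgamated product. -/
def lift (f : A →* P) (g : B →* P) (hfg : ∀ h : H, f h = g (φ h)) : AmalgamatedProduct φ →* P :=
  QuotientGroup.lift _ (Monoid.Coprod.lift f g) <| by
    refine Subgroup.normalClosure_le_normal ?_
    rintro _ ⟨h, rfl⟩
    simp [MonoidHom.mem_ker, hfg]

variable (φ)

/-- The images of the two factors. -/
def factor (b : Bool) : Subgroup (AmalgamatedProduct φ) :=
  cond b (inr φ).range (inl φ).range

theorem iSup_factor : ⨆ b, factor φ b = ⊤ := by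
  rw [eq_top_iff]
  rintro ⟨x⟩ -
  change QuotientGroup.mk' _ x ∈ _
  induction x using Monoid.Coprod.induction_on with
  | inl a => exact Subgroup.mem_iSup_of_mem false ⟨a, rfl⟩
  | inr b => exact Subgroup.mem_iSup_of_mem true ⟨b, rfl⟩
  | mul x y hx hy => rw [map_mul]; exact mul_mem hx hy

variable {φ} {c : Prop} {p : ℕ}

theorem residuallyFiniteOrPFinite [Fact p.Prime] {rA : A →* H} {rB : B →* K}
    (hrA : ∀ h : H, rA h = h) (hrB : ∀ k : K, rB k = k)
    (hA : Group.ResiduallyFiniteOrPFinite c p A) (hB : Group.ResiduallyFiniteOrPFinite c p B) :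
    Group.ResiduallyFiniteOrPFinite c p (AmalgamatedProduct φ) := by
  intro g hg
  let pA : AmalgamatedProduct φ →* A :=
    lift (.id A) (H.subtype.comp (φ.symm.toMonoidHom.comp rB)) (by simp [hrB])
  let pB : AmalgamatedProduct φ →* B :=
    lift (K.subtype.comp (φ.toMonoidHom.comp rA)) (.id B) (by simp [hrA])
  let ρ : AmalgamatedProduct φ →* H := rA.comp pA
  have hpA : ∀ b, pA (inr φ b) = φ.symm (rB b) := fun b => rfl
  have hpB : ∀ a, pB (inl φ a) = φ (rA a) := fun a => rfl
  have hpAA : ∀ a, pA (inl φ a) = a := fun a => rfl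
  have hpBB : ∀ b, pB (inr φ b) = b := fun b => rfl
  have hρA : ∀ a, ρ (inl φ a) = rA a := fun a => rfl
  have hρB : ∀ b, ρ (inr φ b) = φ.symm (rB b) := fun b => by
    simp only [ρ, MonoidHom.comp_apply, hpA, hrA]
  have hrangeH : ∀ b, ((inl φ).comp H.subtype).range ≤ factor φ b := by
    rintro b _ ⟨h, rfl⟩
    cases b
    · exact ⟨h, rfl⟩
    · exact ⟨φ h, (inl_eq_inr φ h).symm⟩
  obtain ⟨h, rfl⟩ | ⟨b, l, hne, hl, rfl⟩ :=
    exists_isAlternating_prod_eq (factor φ) ((inl φ).comp H.subtype).range hrangeH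
      (iSup_factor φ) g
  · refine hA.exists_notMem_of_hom pA fun h1 => hg ?_
    have : (h : A) = 1 := h1
    simp [this]
  -- For a letter from `A`, the listed element is trivial exactly when the letter lies in `H`.
  -- Letters from `B` contribute `1` here, which imposes no condition on `NA`; the roles are
  -- exchanged for `NB`.
  obtain ⟨NA, _, _, hpNA, hNA⟩ := hA.exists_forall_mem_list
    (l.map fun x => (pA x)⁻¹ * ρ x)
  obtain ⟨NB, _, _, hpNB, hNB⟩ := hB.exists_forall_mem_list
    (l.map fun x => (pB x)⁻¹ * φ (ρ x))
  let qA := (QuotientGroup.mk' NA).comp pA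
  let qB := (QuotientGroup.mk' NB).comp pB
  let sA := (QuotientGroup.mk' NA).comp (H.subtype.comp ρ)
  let sB := (QuotientGroup.mk' NB).comp (K.subtype.comp (φ.toMonoidHom.comp ρ))
  -- `e b` projects to the quotient of factor `b` itself and sees the other component only through
  -- `ρ`; `r` uses `ρ` in both components.
  let e : Bool → AmalgamatedProduct φ →* (A ⧸ NA) × (B ⧸ NB) :=
    fun b => cond b (sA.prod qB) (qA.prod sB)
  let r : AmalgamatedProduct φ →* (A ⧸ NA) × (B ⧸ NB) := sA.prod sB
  have hX : ∀ b, ∀ x ∈ factor φ b, e (!b) x = r x := by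
    rintro (_ | _) _ ⟨y, rfl⟩
    · exact Prod.ext rfl rfl
    · refine Prod.ext ?_ rfl
      change ((pA (inr φ y) : A) : A ⧸ NA) = ((ρ (inr φ y) : A) : A ⧸ NA)
      rw [hpA, hρB]
  have hH : ∀ (h : H) b, e b (inl φ h) = r (inl φ h) := by
    intro h b
    simpa using hX (!b) (inl φ h) (hrangeH _ ⟨h, rfl⟩)
  have hl' : IsAlternating (fun b => {x | x ∈ factor φ b ∧ e b x ≠ r x}) b l := by
    refine hl.mono ?_
    rintro (_ | _) x ⟨⟨y, rfl⟩, hxH⟩ hxl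
    · refine ⟨⟨y, rfl⟩, fun heq => hNA _ (List.mem_map_of_mem hxl) (fun h1 => hxH ?_)
        (QuotientGroup.eq.1 (congrArg Prod.fst heq))⟩
      rw [inv_mul_eq_one] at h1
      exact ⟨ρ (inl φ y), congrArg (inl φ) h1.symm⟩
    · refine ⟨⟨y, rfl⟩, fun heq => hNB _ (List.mem_map_of_mem hxl) (fun h1 => hxH ?_)
        (QuotientGroup.eq.1 (congrArg Prod.snd heq))⟩
      rw [inv_mul_eq_one] at h1
      exact ⟨ρ (inr φ y), (inl_eq_inr φ _).trans (congrArg (inr φ) h1.symm)⟩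
  obtain ⟨N, hN, hfin, hp, hlN⟩ := hl'.exists_normal_prod_notMem (p := p) hX (iSup_factor φ)
    (fun N => ⟨lift ((shearHom (ZMod p) N e r false).comp (inl φ))
      ((shearHom (ZMod p) N e r true).comp (inr φ)) (fun h => by
        rw [MonoidHom.comp_apply, MonoidHom.comp_apply, ← inl_eq_inr]
        exact shearHom_eq_shearHom _ _ _ _ (fun b => hH h b) rfl (fun b => hH h b) _ _),
      by rintro (_ | _) _ ⟨y, rfl⟩ <;> rfl⟩) hne
  exact ⟨N, hN, hfin, fun h => hp ((hpNA h).prod (hpNB h)), hlN⟩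

theorem residuallyFiniteOrPFinite_iff [Fact p.Prime] (hH : H.IsRetract) (hK : K.IsRetract) :
    Group.ResiduallyFiniteOrPFinite c p (AmalgamatedProduct φ) ↔
      Group.ResiduallyFiniteOrPFinite c p A ∧ Group.ResiduallyFiniteOrPFinite c p B := by
  obtain ⟨rA, hrA⟩ := hH.exists_retraction
  obtain ⟨rB, hrB⟩ := hK.exists_retraction
  refine ⟨fun h => ⟨h.of_injective (inl φ) ?_, h.of_injective (inr φ) ?_⟩,
    fun h => residuallyFiniteOrPFinite hrA hrB h.1 h.2⟩
  · exact Function.LeftInverse.injective (g := lift (.id A)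
      (H.subtype.comp (φ.symm.toMonoidHom.comp rB)) (by simp [hrB])) fun _ => rfl
  · exact Function.LeftInverse.injective (g := lift
      (K.subtype.comp (φ.toMonoidHom.comp rA)) (.id B) (by simp [hrA])) fun _ => rfl

end AmalgamatedProduct

theorem mainTheorem2 {A B : Type*} [Group A] [Group B] (H : Subgroup A) (K : Subgroup B)
    (φ : H ≃* K) (hH : H.IsRetract) (hK : K.IsRetract) :
    (Group.ResiduallyFinite (AmalgamatedProduct φ) ↔
      Group.ResiduallyFinite A ∧ Group.ResiduallyFinite B) ∧
    ∀ p : ℕ, p.Prime →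
      (Group.ResiduallyPFinite p (AmalgamatedProduct φ) ↔
        Group.ResiduallyPFinite p A ∧ Group.ResiduallyPFinite p B) := by
  constructor
  -- Any prime would do: it only supplies a finite coefficient field.
  · have : Fact (Nat.Prime 2) := ⟨Nat.prime_two⟩
    simp only [← Group.ResiduallyFiniteOrPFinite.false_iff 2]
    exact AmalgamatedProduct.residuallyFiniteOrPFinite_iff hH hK
  · intro p hp
    have : Fact p.Prime := ⟨hp⟩
    simp only [← Group.ResiduallyFiniteOrPFinite.true_iff]
    exact AmalgamatedProduct.residuallyFiniteOrPFinite_iff hH hK
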